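/- Let $\mathcal H=\mathcal H_1\oplus\mathcal H_2\oplus\mathcal H_3$ be an orthogonal direct sum of finite-dimensional complex Hilbert spaces, let $\mathcal F(\mathcal K)$ denote the symmetric Fock space over $\mathcal K$, and identify $B(\mathcal F(\mathcal H))$ with (the von Neumann algebra tensor product) $B(\mathcal F(\mathcal H_1))\otimes B(\mathcal F(\mathcal H_2))\otimes B(\mathcal F(\mathcal H_3))$. For a positive operator $A\in B(\mathcal H)$ let $\omega_A$ be the quasi-free state given on the Weyl unitaries $W(f)$ of the Fock representation of the canonical commutation relations over $\mathcal H$ by $$\omega_A(W(f))=\exp\bigl(-\tfrac12\|f\|^2-\langle f,Af\rangle\bigr)\qquad(f\in\mathcal H),$$ and let $D_{123}$ be its statistical operator on $\mathcal F(\mathcal H)$. Let $D_{12}$, $D_{23}$, $D_2$ be the reductions (partial traces) of $D_{123}$ to $\mathcal F(\mathcal H_1\oplus\mathcal H_2)$, $\mathcal F(\mathcal H_2\oplus\mathcal H_3)$ and $\mathcal F(\mathcal H_2)$. We say that $A$ gives a Markov triplet if the von Neumann entropies $S(D)=-\operatorname{Tr}D\log D$ of these four operators are finite and $$S(D_{123})-S(D_{23})=S(D_{12})-S(D_2).$$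 If $A$ gives a Markov triplet and $U=\mathrm{Diag}(U_1,U_2,U_3)$ with unitaries $U_i\in B(\mathcal H_i)$, $1\le i\le 3$, then $U^*AU$ is positive and also gives a Markov triplet. -/

import Mathlib

open scoped InnerProductSpace TensorProduct ComplexOrder

universe u

namespace CCRMarkov

theorem eq_zero_of_forall_hasSum_pow {c : ℕ → ℂ}
    (h : ∀ z : ℂ, HasSum (fun n => c n * z ^ n) 0) (n : ℕ) : c n = 0 := by
  have hb : HasFPowerSeriesAt (0 : ℂ → ℂ) (FormalMultilinearSeries.ofScalars ℂ c) 0 := by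
    refine ⟨1, ⟨?_, one_pos, ?_⟩⟩
    · obtain ⟨C, hC⟩ := (h 1).summable.tendsto_atTop_zero.norm.bddAbove_range
      refine FormalMultilinearSeries.le_radius_of_bound _ (r := 1) C fun n => ?_
      have := hC ⟨n, rfl⟩
      simpa using this
    · intro y _
      simpa [FormalMultilinearSeries.ofScalars, mul_comm] using h y
  have := congrArg (fun p => FormalMultilinearSeries.coeff p n) hb.eq_zero
  rw [FormalMultilinearSeries.coeff_ofScalars] at this
  rw [this]
  rfl

/-! ### Symmetric tensor powers and the symmetric Fock space -/

section Fock

variable (n : ℕ) (H : Type u) [NormedAddCommGroup H] [InnerProductSpace ℂ H]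
  [FiniteDimensional ℂ H]

/-- The `n`-fold tensor power of `H`, as a vector space. -/
def TPow : Type u := PiTensorProduct ℂ (fun _ : Fin n => H)

@[reducible] noncomputable def TPow.addCommGroup : AddCommGroup (TPow n H) :=
  inferInstanceAs (AddCommGroup (PiTensorProduct ℂ (fun _ : Fin n => H)))

attribute [local instance] TPow.addCommGroup in
@[reducible] noncomputable def TPow.module : Module ℂ (TPow n H) :=
  inferInstanceAs (Module ℂ (PiTensorProduct ℂ (fun _ : Fin n => H)))

section Core

attribute [local instance] TPow.addCommGroup TPow.module

/-- The basis of the tensor power induced by an orthonormal basis of `H`. -/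
noncomputable def TPow.basis :
    Module.Basis (Fin n → Fin (Module.finrank ℂ H)) ℂ (TPow n H) :=
  Basis.piTensorProduct (R := ℂ) (fun _ : Fin n => (stdOrthonormalBasis ℂ H).toBasis)

/-- Coordinates with respect to `TPow.basis`, valued in a Euclidean space. -/
noncomputable def TPow.coord :
    TPow n H ≃ₗ[ℂ] EuclideanSpace ℂ (Fin n → Fin (Module.finrank ℂ H)) :=
  (TPow.basis n H).equivFun ≪≫ₗ (WithLp.linearEquiv 2 ℂ _).symm

/-- The inner product on the tensor power for which `TPow.basis` is orthonormal; it is the usual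
one, `⟪f₁ ⊗ ⋯ ⊗ fₙ, g₁ ⊗ ⋯ ⊗ gₙ⟫ = ∏ ⟪fᵢ, gᵢ⟫`, by `TPow.inner_tprod`. -/
@[reducible] noncomputable def TPow.core : InnerProductSpace.Core ℂ (TPow n H) where
  inner x y := ⟪TPow.coord n H x, TPow.coord n H y⟫_ℂ
  conj_inner_symm x y := inner_conj_symm _ _
  re_inner_nonneg x := inner_self_nonneg
  add_left x y z := by simp
  smul_left x y r := by simp [mul_comm]
  definite x h := by simpa using h

noncomputable instance : NormedAddCommGroup (TPow n H) :=
  (TPow.core n H).toNormedAddCommGroup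

noncomputable instance : InnerProductSpace ℂ (TPow n H) :=
  InnerProductSpace.ofCore (TPow.core n H).toCore

instance : FiniteDimensional ℂ (TPow n H) := Module.Finite.of_basis (TPow.basis n H)

end Core

variable {n H}

/-- The elementary tensor `f 0 ⊗ ⋯ ⊗ f (n-1)`. -/
noncomputable def TPow.tprod : MultilinearMap ℂ (fun _ : Fin n => H) (TPow n H) :=
  PiTensorProduct.tprod ℂ

/-- The operator `U_π` permuting the tensor factors. -/
noncomputable def TPow.perm (π : Equiv.Perm (Fin n)) : TPow n H ≃ₗ[ℂ] TPow n H :=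
  PiTensorProduct.reindex ℂ (fun _ : Fin n => H) π

theorem TPow.inner_tprod (f g : Fin n → H) :
    ⟪TPow.tprod f, TPow.tprod g⟫_ℂ = ∏ i, ⟪f i, g i⟫_ℂ := by
  have h1 : ⟪TPow.tprod f, TPow.tprod g⟫_ℂ
      = ⟪TPow.coord n H (TPow.tprod f), TPow.coord n H (TPow.tprod g)⟫_ℂ := rfl
  have hc : ∀ (f : Fin n → H) (p : Fin n → Fin (Module.finrank ℂ H)),
      TPow.coord n H (TPow.tprod f) p = ∏ i, ⟪stdOrthonormalBasis ℂ H (p i), f i⟫_ℂ := by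
    intro f p
    have := Basis.piTensorProduct_repr_tprod_apply (R := ℂ)
      (fun _ : Fin n => (stdOrthonormalBasis ℂ H).toBasis) f p
    simp only [OrthonormalBasis.coe_toBasis_repr_apply, OrthonormalBasis.repr_apply_apply] at this
    exact this
  rw [h1, PiLp.inner_apply]
  simp only [hc, RCLike.inner_apply, map_prod, inner_conj_symm]
  simp_rw [← (stdOrthonormalBasis ℂ H).sum_inner_mul_inner (f _) (g _)]
  rw [Finset.prod_univ_sum, Fintype.piFinset_univ]
  refine Finset.sum_congr rfl fun p _ => ?_
  rw [← Finset.prod_mul_distrib]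
  exact Finset.prod_congr rfl fun i _ => mul_comm _ _

theorem TPow.span_tprod :
    Submodule.span ℂ (Set.range (TPow.tprod (n := n) (H := H))) = ⊤ :=
  PiTensorProduct.span_tprod_eq_top

theorem TPow.perm_tprod (π : Equiv.Perm (Fin n)) (f : Fin n → H) :
    TPow.perm π (TPow.tprod f) = TPow.tprod (fun i => f (π.symm i)) :=
  PiTensorProduct.reindex_tprod π f

variable (n H)

/-- The symmetric subspace `H^{∨n}` of the `n`-fold tensor power. -/
noncomputable def symTensors : Submodule ℂ (TPow n H) where
  carrier := {x | ∀ π : Equiv.Perm (Fin n), TPow.perm π x = x}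
  add_mem' hx hy π := by rw [map_add, hx π, hy π]
  zero_mem' π := map_zero _
  smul_mem' c x hx π := by rw [map_smul, hx π]

instance : CompleteSpace (symTensors n H) := FiniteDimensional.complete ℂ _

/-- The symmetric Fock space: the Hilbert space direct sum of all the `H^{∨n}`. -/
def Fock : Type u := lp (fun n => symTensors n H) 2

noncomputable instance : NormedAddCommGroup (Fock H) :=
  inferInstanceAs (NormedAddCommGroup (lp (fun n => symTensors n H) 2))

noncomputable instance : InnerProductSpace ℂ (Fock H) :=
  inferInstanceAs (InnerProductSpace ℂ (lp (fun n => symTensors n H) 2))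

instance : CompleteSpace (Fock H) :=
  inferInstanceAs (CompleteSpace (lp (fun n => symTensors n H) 2))

/-- The `n`-particle component of a Fock space vector. -/
def Fock.component {H : Type u} [NormedAddCommGroup H] [InnerProductSpace ℂ H]
    [FiniteDimensional ℂ H] (ψ : Fock H) (n : ℕ) : symTensors n H :=
  (show lp (fun n => symTensors n H) 2 from ψ) n

theorem Fock.hasSum_inner {H : Type u} [NormedAddCommGroup H] [InnerProductSpace ℂ H]
    [FiniteDimensional ℂ H] (φ ψ : Fock H) :
    HasSum (fun n => ⟪φ.component n, ψ.component n⟫_ℂ) ⟪φ, ψ⟫_ℂ :=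
  lp.hasSum_inner (𝕜 := ℂ) (G := fun n => symTensors n H) φ ψ

variable {H}

/-- The vector `f ⊗ ⋯ ⊗ f` of `H^{∨n}`. -/
noncomputable def powVec (f : H) : symTensors n H :=
  ⟨TPow.tprod (fun _ => f), fun π => TPow.perm_tprod π _⟩

theorem inner_powVec (f g : H) : ⟪powVec n f, powVec n g⟫_ℂ = ⟪f, g⟫_ℂ ^ n := by
  rw [Submodule.coe_inner]
  simp [powVec, TPow.inner_tprod]

theorem expVec_term (f g : H) :
    ⟪((Real.sqrt n.factorial : ℂ)⁻¹) • powVec n f,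
      ((Real.sqrt n.factorial : ℂ)⁻¹) • powVec n g⟫_ℂ = ⟪f, g⟫_ℂ ^ n / n.factorial := by
  have h0 : (0 : ℝ) ≤ n.factorial := by positivity
  have h : ((Real.sqrt n.factorial : ℝ) : ℂ) * (Real.sqrt n.factorial : ℝ)
      = (n.factorial : ℂ) := by
    rw [← Complex.ofReal_mul, Real.mul_self_sqrt h0]; simp
  rw [inner_smul_left, inner_smul_right, inner_powVec, map_inv₀, Complex.conj_ofReal, ← h]
  field_simp

theorem memℓp_expVec (f : H) :
    Memℓp (fun n => ((Real.sqrt n.factorial : ℂ)⁻¹) • powVec n f) 2 := by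
  apply memℓp_gen
  refine ((Real.summable_pow_div_factorial (‖f‖ ^ 2)).congr fun n => ?_)
  have h := congrArg Complex.re (expVec_term n f f)
  have h2 : ⟪f, f⟫_ℂ ^ n / (n.factorial : ℂ) = (((‖f‖ ^ 2) ^ n / n.factorial : ℝ) : ℂ) := by
    rw [inner_self_eq_norm_sq_to_K]; push_cast; rfl
  rw [h2, Complex.ofReal_re] at h
  rw [← h]
  simp only [ENNReal.toReal_ofNat, Real.rpow_ofNat]
  exact inner_self_eq_norm_sq (𝕜 := ℂ) _

/-- The exponential vector `e(f) = ∑ₙ f^{⊗n} / √n!`. -/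
noncomputable def expVec (f : H) : Fock H :=
  ⟨fun n => ((Real.sqrt n.factorial : ℂ)⁻¹) • powVec n f, memℓp_expVec f⟩

theorem inner_expVec (f g : H) : ⟪expVec f, expVec g⟫_ℂ = Complex.exp ⟪f, g⟫_ℂ := by
  refine (Fock.hasSum_inner (expVec f) (expVec g)).unique ?_
  rw [Complex.exp_eq_exp_ℂ]
  rw [show (fun n => ⟪(expVec f).component n, (expVec g).component n⟫_ℂ)
    = fun n => ⟪f, g⟫_ℂ ^ n / n.factorial from funext fun n => expVec_term n f g]
  exact NormedSpace.expSeries_div_hasSum_exp (𝔸 := ℂ) ⟪f, g⟫_ℂ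

theorem symTensors_eq_zero {n : ℕ} (x : symTensors n H) (h : ∀ f : H, ⟪x, powVec n f⟫_ℂ = 0) :
    x = 0 := by
  let m : ContinuousMultilinearMap ℂ (fun _ : Fin n => H) (TPow n H) :=
    TPow.tprod.mkContinuous 1 fun v => by
      have h1 : ‖TPow.tprod v‖ ^ 2 = (∏ i, ‖v i‖) ^ 2 := by
        have := TPow.inner_tprod v v
        simp only [inner_self_eq_norm_sq_to_K] at this
        rw [← Finset.prod_pow]
        exact_mod_cast this
      rw [one_mul, (sq_eq_sq₀ (norm_nonneg _) (by positivity)).1 h1]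
  let m' := (innerSL ℂ (x : TPow n H)).compContinuousMultilinearMap m
  have hd : (fun f : H => m' (fun _ => f)) = 0 := funext fun f => h f
  have hz : ∀ z : TPow n H, ⟪(x : TPow n H), ∑ σ : Equiv.Perm (Fin n), TPow.perm σ z⟫_ℂ = 0 := by
    intro z
    have hz : z ∈ Submodule.span ℂ (Set.range (TPow.tprod (n := n) (H := H))) := by
      rw [TPow.span_tprod]; trivial
    induction hz using Submodule.span_induction with
    | mem z hz =>
      obtain ⟨v, rfl⟩ := hz
      have h2 := m'.iteratedFDeriv_comp_diagonal 0 v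
      rw [hd] at h2
      have h0 : iteratedFDeriv ℂ n (0 : H → ℂ) 0 = 0 := by
        exact congrFun (iteratedFDeriv_fun_zero (𝕜 := ℂ) (E := H) (F := ℂ) (n := n)) 0
      rw [h0] at h2
      rw [inner_sum, ← Equiv.sum_comp (Equiv.inv _)]
      simp only [TPow.perm_tprod]
      exact h2.symm
    | zero => simp
    | add y z _ _ hy hz => simp only [map_add, Finset.sum_add_distrib, inner_add_right, hy, hz, add_zero]
    | smul c z _ hz => simp only [map_smul, ← Finset.smul_sum, inner_smul_right, hz, mul_zero]
  have h3 := hz x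
  rw [Finset.sum_congr rfl fun σ _ => x.2 σ, Finset.sum_const, ← Nat.cast_smul_eq_nsmul ℂ,
    inner_smul_right, mul_eq_zero, inner_self_eq_zero] at h3
  rcases h3 with h3 | h3
  · simp [Fintype.card_perm, Nat.factorial_ne_zero] at h3
  · exact Subtype.ext h3

/-- The exponential vectors are total in the Fock space. -/
theorem span_expVec_dense :
    Dense (Submodule.span ℂ (Set.range (expVec (H := H))) : Set (Fock H)) := by
  rw [Submodule.dense_iff_topologicalClosure_eq_top, Submodule.topologicalClosure_eq_top_iff,
    Submodule.eq_bot_iff]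
  intro ψ hψ
  rw [Submodule.mem_orthogonal'] at hψ
  refine lp.ext (funext fun n => ?_)
  refine symTensors_eq_zero (ψ.component n) fun f => ?_
  have hs : ∀ z : ℂ, HasSum (fun n => ((Real.sqrt n.factorial : ℂ)⁻¹ * ⟪ψ.component n, powVec n f⟫_ℂ) * z ^ n)
      0 := by
    intro z
    have h1 := Fock.hasSum_inner ψ (expVec (z • f))
    rw [hψ _ (Submodule.subset_span ⟨_, rfl⟩)] at h1
    suffices hc : ∀ n, ⟪ψ.component n, (expVec (z • f)).component n⟫_ℂ
        = ((Real.sqrt n.factorial : ℂ)⁻¹ * ⟪ψ.component n, powVec n f⟫_ℂ) * z ^ n by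
      simpa only [hc] using h1
    intro n
    have h2 : powVec n (z • f) = z ^ n • powVec n f := by
      apply Subtype.ext
      have := (TPow.tprod (n := n) (H := H)).map_smul_univ (fun _ => z) (fun _ => f)
      simpa [powVec] using this
    change ⟪ψ.component n, ((Real.sqrt n.factorial : ℂ)⁻¹) • powVec n (z • f)⟫_ℂ = _
    rw [h2, inner_smul_right, inner_smul_right]
    ring
  have h4 := eq_zero_of_forall_hasSum_pow hs n
  rw [mul_eq_zero] at h4
  refine h4.resolve_left (inv_ne_zero ?_)
  exact_mod_cast (Real.sqrt_pos.2 (by positivity)).ne'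

end Fock

section Isometry

variable {X E F : Type*} [NormedAddCommGroup E] [InnerProductSpace ℂ E]
  [NormedAddCommGroup F] [InnerProductSpace ℂ F] [CompleteSpace F]

/-- A total family can be mapped isometrically onto any family with the same Gram matrix. -/
theorem exists_isometry (v : X → E) (w : X → F)
    (hv : Dense (Submodule.span ℂ (Set.range v) : Set E))
    (h : ∀ x y, ⟪w x, w y⟫_ℂ = ⟪v x, v y⟫_ℂ) : ∃ V : E →ₗᵢ[ℂ] F, ∀ x, V (v x) = w x := by
  let e : (X →₀ ℂ) →ₗ[ℂ] E := Finsupp.linearCombination ℂ v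
  let f : (X →₀ ℂ) →ₗ[ℂ] F := Finsupp.linearCombination ℂ w
  have he : DenseRange e := by
    rw [← Finsupp.range_linearCombination] at hv
    exact hv
  have hn : ∀ c, ‖f c‖ = ‖e c‖ := by
    intro c
    have h1 : ⟪f c, f c⟫_ℂ = ⟪e c, e c⟫_ℂ := by
      simp only [e, f, Finsupp.linearCombination_apply, Finsupp.sum, sum_inner, inner_sum,
        inner_smul_left, inner_smul_right, h]
    simp only [inner_self_eq_norm_sq_to_K] at h1
    have h2 : ‖f c‖ ^ 2 = ‖e c‖ ^ 2 := by exact_mod_cast h1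
    exact (sq_eq_sq₀ (norm_nonneg _) (norm_nonneg _)).1 h2
  have hb : ∃ C, ∀ c, ‖f c‖ ≤ C * ‖e c‖ := ⟨1, fun c => by rw [one_mul, hn]⟩
  have hext : ∀ c, f.extendOfNorm e (e c) = f c := LinearMap.extendOfNorm_eq he hb
  refine ⟨⟨(f.extendOfNorm e).toLinearMap, fun x => ?_⟩, fun x => ?_⟩
  · refine he.induction_on (p := fun x => ‖f.extendOfNorm e x‖ = ‖x‖) x ?_ ?_
    · exact isClosed_eq (by fun_prop) (by fun_prop)
    · intro c; rw [hext, hn]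
  · have := hext (Finsupp.single x 1)
    simpa [e, f] using this

end Isometry

/-! ### Weyl unitaries -/

section Weyl

variable {H : Type u} [NormedAddCommGroup H] [InnerProductSpace ℂ H] [FiniteDimensional ℂ H]

theorem exists_weyl (f : H) : ∃ W : Fock H →ₗᵢ[ℂ] Fock H, ∀ g : H,
    W (expVec g) = Complex.exp (-(‖f‖ ^ 2 / 2 : ℝ) - ⟪f, g⟫_ℂ) • expVec (f + g) := by
  refine exists_isometry _ _ span_expVec_dense fun g h => ?_
  rw [inner_smul_left, inner_smul_right, inner_expVec, inner_expVec, ← Complex.exp_conj,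
    ← Complex.exp_add, ← Complex.exp_add]
  congr 1
  simp only [map_sub, map_neg, Complex.conj_ofReal, inner_conj_symm, inner_add_left,
    inner_add_right]
  rw [inner_self_eq_norm_sq_to_K (𝕜 := ℂ) f]
  push_cast
  simp only [Complex.coe_algebraMap]
  ring

/-- The Weyl unitary `W(f) = exp (a⁺(f) - a(f))` of the Fock representation, determined by
`W(f) e(g) = exp (-‖f‖²/2 - ⟪f, g⟫) e(f + g)`. -/
noncomputable def weyl (f : H) : Fock H →L[ℂ] Fock H :=
  (Classical.choose (exists_weyl f)).toContinuousLinearMap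

theorem weyl_expVec (f g : H) : weyl f (expVec g) =
    Complex.exp (-(‖f‖ ^ 2 / 2 : ℝ) - ⟪f, g⟫_ℂ) • expVec (f + g) :=
  Classical.choose_spec (exists_weyl f) g

theorem ext_expVec {E : Type*} [NormedAddCommGroup E] [NormedSpace ℂ E]
    {S T : Fock H →L[ℂ] E} (h : ∀ g, S (expVec g) = T (expVec g)) : S = T :=
  ContinuousLinearMap.ext_on span_expVec_dense (by rintro _ ⟨g, rfl⟩; exact h g)

/-- The Weyl form of the canonical commutation relations. -/
theorem weyl_mul (f g : H) :
    weyl f * weyl g = Complex.exp (Complex.I * (⟪g, f⟫_ℂ).im) • weyl (f + g) := by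
  refine ext_expVec fun k => ?_
  simp only [mul_apply_eq_comp, smul_apply, weyl_expVec, map_smul,
    smul_smul, ← Complex.exp_add, add_assoc]
  congr 2
  have h1 : (‖f + g‖ ^ 2 : ℝ) = ‖f‖ ^ 2 + 2 * (⟪f, g⟫_ℂ).re + ‖g‖ ^ 2 :=
    norm_add_sq (𝕜 := ℂ) f g
  have h2 : (⟪f, g⟫_ℂ) = (⟪f, g⟫_ℂ).re - Complex.I * (⟪g, f⟫_ℂ).im := by
    rw [← inner_conj_symm g f]
    apply Complex.ext <;> simp [-inner_conj_symm]
  rw [h1, inner_add_right, inner_add_left]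
  nth_rw 1 [h2]
  push_cast
  ring

theorem weyl_zero : weyl (0 : H) = 1 := ext_expVec fun g => by simp [weyl_expVec]

theorem weyl_neg (f : H) : weyl (-f) = star (weyl f) := by
  have h1 : star (weyl f) * weyl f = 1 :=
    (Classical.choose (exists_weyl f)).adjoint_comp_self
  have h2 : weyl f * weyl (-f) = 1 := by
    have h0 : (⟪f, f⟫_ℂ).im = 0 := inner_self_im (𝕜 := ℂ) f
    rw [weyl_mul, add_neg_cancel, weyl_zero, inner_neg_left, Complex.neg_im, h0]
    simp
  exact (left_inv_eq_right_inv h1 h2).symm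

end Weyl

/-! ### Tensor decomposition of the Fock space and reductions -/

section Decomposition

variable {ι : Type} [Fintype ι] [DecidableEq ι] {𝓗 : ι → Type u} [∀ i, NormedAddCommGroup (𝓗 i)]
  [∀ i, InnerProductSpace ℂ (𝓗 i)]

/-- The direct sum of the `𝓗 i` with `i ∈ s`. -/
abbrev Sub (𝓗 : ι → Type u) (s : Finset ι) : Type u :=
  PiLp 2 (fun i : {i // i ∈ s} => 𝓗 i)

variable (s : Finset ι)

/-- The vector `f ⊕ g` of the whole direct sum, for `f` in the partial sum over `i ∈ s`
and `g` in the complementary partial sum. -/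
noncomputable def glue (f : Sub 𝓗 s) (g : Sub 𝓗 sᶜ) : PiLp 2 𝓗 :=
  WithLp.toLp 2 fun i => if h : i ∈ s then f ⟨i, h⟩ else g ⟨i, Finset.mem_compl.2 h⟩

theorem inner_glue (f f' : Sub 𝓗 s) (g g' : Sub 𝓗 sᶜ) :
    ⟪glue s f g, glue s f' g'⟫_ℂ = ⟪f, f'⟫_ℂ + ⟪g, g'⟫_ℂ := by
  simp only [PiLp.inner_apply]
  rw [← Finset.sum_add_sum_compl s, ← Finset.sum_coe_sort s, ← Finset.sum_coe_sort sᶜ]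
  congr 1
  · exact Finset.sum_congr rfl fun i _ => by simp [glue, i.2]
  · exact Finset.sum_congr rfl fun i _ => by simp [glue, Finset.mem_compl.1 i.2]

end Decomposition

section Tensor

theorem dense_span_tmul {X Y E F : Type*} [NormedAddCommGroup E] [InnerProductSpace ℂ E]
    [NormedAddCommGroup F] [InnerProductSpace ℂ F] (v : X → E) (w : Y → F)
    (hv : Dense (Submodule.span ℂ (Set.range v) : Set E))
    (hw : Dense (Submodule.span ℂ (Set.range w) : Set F)) :
    Dense (Submodule.span ℂ (Set.range fun x : X × Y => v x.1 ⊗ₜ[ℂ] w x.2) :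
      Set (E ⊗[ℂ] F)) := by
  set S := Submodule.span ℂ (Set.range fun x : X × Y => v x.1 ⊗ₜ[ℂ] w x.2)
  rw [Submodule.dense_iff_topologicalClosure_eq_top, eq_top_iff, ← TensorProduct.span_tmul_eq_top,
    Submodule.span_le]
  have h1 : ∀ x b, v x ⊗ₜ[ℂ] b ∈ S.topologicalClosure := by
    intro x b
    have hm : Set.MapsTo (fun b => v x ⊗ₜ[ℂ] b) (Submodule.span ℂ (Set.range w) : Set F) S := by
      intro b hb
      induction hb using Submodule.span_induction with
      | mem b hb => obtain ⟨y, rfl⟩ := hb; exact Submodule.subset_span ⟨(x, y), rfl⟩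
      | zero => simp
      | add b c _ _ hb hc => simpa [TensorProduct.tmul_add] using S.add_mem hb hc
      | smul r b _ hb => simpa using S.smul_mem r hb
    exact hm.closure (by fun_prop) (hw b)
  rintro _ ⟨a, b, rfl⟩
  set T := S.topologicalClosure with hT
  have hm : Set.MapsTo (fun a => a ⊗ₜ[ℂ] b) (Submodule.span ℂ (Set.range v) : Set E)
      T := by
    intro a ha
    induction ha using Submodule.span_induction with
    | mem a ha => obtain ⟨x, rfl⟩ := ha; exact h1 x b
    | zero => simp
    | add a c _ _ ha hc => simpa [TensorProduct.add_tmul] using T.add_mem ha hc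
    | smul r a _ ha => simpa [TensorProduct.smul_tmul'] using T.smul_mem r ha
  have := hm.closure (by fun_prop) (hv a)
  rwa [hT, Submodule.topologicalClosure_coe, closure_closure] at this

variable {ι : Type} [Fintype ι] [DecidableEq ι] {𝓗 : ι → Type u} [∀ i, NormedAddCommGroup (𝓗 i)]
  [∀ i, InnerProductSpace ℂ (𝓗 i)] [∀ i, FiniteDimensional ℂ (𝓗 i)] (s : Finset ι)

theorem exists_fockTensor :
    ∃ J : Fock (Sub 𝓗 s) ⊗[ℂ] Fock (Sub 𝓗 sᶜ) →ₗᵢ[ℂ] Fock (PiLp 2 𝓗),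
      ∀ x : Sub 𝓗 s × Sub 𝓗 sᶜ,
        J (expVec x.1 ⊗ₜ[ℂ] expVec x.2) = expVec (glue s x.1 x.2) := by
  refine exists_isometry _ _ (dense_span_tmul _ _ (span_expVec_dense (H := Sub 𝓗 s))
    (span_expVec_dense (H := Sub 𝓗 sᶜ))) ?_
  intro x y
  rw [TensorProduct.inner_tmul, inner_expVec, inner_expVec, inner_expVec, inner_glue,
    Complex.exp_add]

/-- The identification of `F(𝓗₁) ⊗ F(𝓗₂)` with (a dense subspace of) `F(𝓗₁ ⊕ 𝓗₂)`, where `𝓗₁` is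
the sum of the `𝓗 i` with `i ∈ s` and `𝓗₂` the sum of the others; it is the isometry with
`e(f) ⊗ e(g) ↦ e(f ⊕ g)`. -/
noncomputable def fockTensor :
    Fock (Sub 𝓗 s) ⊗[ℂ] Fock (Sub 𝓗 sᶜ) →ₗᵢ[ℂ] Fock (PiLp 2 𝓗) :=
  Classical.choose (exists_fockTensor s)

theorem fockTensor_expVec (f : Sub 𝓗 s) (g : Sub 𝓗 sᶜ) :
    fockTensor s (expVec f ⊗ₜ[ℂ] expVec g) = expVec (glue s f g) :=
  Classical.choose_spec (exists_fockTensor s) (f, g)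

/-- `D'` is the reduction (partial trace) of the operator `D` on
`F(⊕ 𝓗 i) = F(𝓗₁) ⊗ F(𝓗₂)` to the first tensor factor `F(𝓗₁)`, where `𝓗₁` is the sum of the
`𝓗 i` with `i ∈ s`. -/
def IsReduction (D : Fock (PiLp 2 𝓗) →L[ℂ] Fock (PiLp 2 𝓗))
    (D' : Fock (Sub 𝓗 s) →L[ℂ] Fock (Sub 𝓗 s)) : Prop :=
  ∀ (κ : Type u) (b : HilbertBasis κ ℂ (Fock (Sub 𝓗 sᶜ))) (φ ψ : Fock (Sub 𝓗 s)),
    HasSum (fun k => ⟪fockTensor s (φ ⊗ₜ[ℂ] b k), D (fockTensor s (ψ ⊗ₜ[ℂ] b k))⟫_ℂ) ⟪φ, D' ψ⟫_ℂ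

end Tensor

/-! ### Statistical operators and von Neumann entropy -/

section Entropy

variable {K : Type u} [NormedAddCommGroup K] [InnerProductSpace ℂ K]

/-- The operator `T` has the trace `t`: the diagonal sum `∑ ⟪bₖ, T bₖ⟫` converges to `t` in every
orthonormal basis. (The diagonal sums of a bounded operator on a Hilbert space converge in every
orthonormal basis exactly when it is of trace class.) -/
def HasTrace (T : K →L[ℂ] K) (t : ℂ) : Prop :=
  ∀ (κ : Type u) (b : HilbertBasis κ ℂ K), HasSum (fun k => ⟪b k, T (b k)⟫_ℂ) t

/-- Statistical operators: positive operators of trace `1`. -/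
def IsStatisticalOperator (D : K →L[ℂ] K) : Prop :=
  D.IsPositive ∧ HasTrace D 1

/-- The von Neumann entropy `S(D) = Tr η(D)`, `η(t) = -t log t`, is finite and equal to `s`. -/
def HasEntropy [CompleteSpace K] (D : K →L[ℂ] K) (s : ℝ) : Prop :=
  HasTrace (cfc Real.negMulLog D) (s : ℂ)

theorem HasTrace.unique [CompleteSpace K] {T : K →L[ℂ] K} {s t : ℂ} (hs : HasTrace T s)
    (ht : HasTrace T t) : s = t := by
  obtain ⟨w, b, _⟩ := exists_hilbertBasis ℂ K
  exact (hs _ b).unique (ht _ b)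

end Entropy

/-! ### Quasi-free states and Markov triplets -/

section QuasiFree

/-- `D` is the statistical operator, in the Fock representation, of the quasi-free state
`ω_A(W(f)) = exp (-‖f‖²/2 - ⟪f, A f⟫)`. -/
def IsQuasiFreeStatisticalOperator {H : Type u} [NormedAddCommGroup H] [InnerProductSpace ℂ H]
    [FiniteDimensional ℂ H] (A : H →L[ℂ] H) (D : Fock H →L[ℂ] Fock H) : Prop :=
  IsStatisticalOperator D ∧
    ∀ f : H, HasTrace (D ∘L weyl f) (Complex.exp (-(‖f‖ ^ 2 / 2 : ℝ) - ⟪f, A f⟫_ℂ))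

variable {𝓗 : Fin 3 → Type u} [∀ i, NormedAddCommGroup (𝓗 i)]
  [∀ i, InnerProductSpace ℂ (𝓗 i)] [∀ i, FiniteDimensional ℂ (𝓗 i)]

/-- The Markov triplet property of the statistical operator `D = D₁₂₃` (the three summands are
numbered `0, 1, 2`): the entropies of `D₁₂₃` and of its reductions `D₁₂`, `D₂₃`, `D₂` are finite and
`S(D₁₂₃) - S(D₂₃) = S(D₁₂) - S(D₂)`. -/
def IsMarkovTriplet (D : Fock (PiLp 2 𝓗) →L[ℂ] Fock (PiLp 2 𝓗)) : Prop :=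
  ∃ (D₁₂ : Fock (Sub 𝓗 {0, 1}) →L[ℂ] Fock (Sub 𝓗 {0, 1}))
    (D₂₃ : Fock (Sub 𝓗 {1, 2}) →L[ℂ] Fock (Sub 𝓗 {1, 2}))
    (D₂ : Fock (Sub 𝓗 {1}) →L[ℂ] Fock (Sub 𝓗 {1}))
    (s₁₂₃ s₁₂ s₂₃ s₂ : ℝ),
    IsReduction {0, 1} D D₁₂ ∧ IsReduction {1, 2} D D₂₃ ∧ IsReduction {1} D D₂ ∧
    HasEntropy D s₁₂₃ ∧ HasEntropy D₁₂ s₁₂ ∧ HasEntropy D₂₃ s₂₃ ∧ HasEntropy D₂ s₂ ∧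
    s₁₂₃ - s₂₃ = s₁₂ - s₂

/-- The positive operator `A` on `𝓗₁ ⊕ 𝓗₂ ⊕ 𝓗₃` gives a Markov triplet: the statistical operator
of the quasi-free state `ω_A` has the Markov triplet property. -/
def GivesMarkovTriplet (A : PiLp 2 𝓗 →L[ℂ] PiLp 2 𝓗) : Prop :=
  A.IsPositive ∧ ∃ D : Fock (PiLp 2 𝓗) →L[ℂ] Fock (PiLp 2 𝓗),
    IsQuasiFreeStatisticalOperator A D ∧ IsMarkovTriplet D

end QuasiFree

section BlockDiag

variable {𝓗 : Fin 3 → Type u} [∀ i, NormedAddCommGroup (𝓗 i)] [∀ i, InnerProductSpace ℂ (𝓗 i)]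

/-- The block diagonal operator `Diag(U₁, U₂, U₃)`. -/
noncomputable def blockDiag (U : ∀ i, 𝓗 i →L[ℂ] 𝓗 i) : PiLp 2 𝓗 →L[ℂ] PiLp 2 𝓗 :=
  (PiLp.continuousLinearEquiv 2 ℂ 𝓗).symm.toContinuousLinearMap ∘L
    ContinuousLinearMap.pi (fun i => U i ∘L ContinuousLinearMap.proj i) ∘L
    (PiLp.continuousLinearEquiv 2 ℂ 𝓗).toContinuousLinearMap

theorem blockDiag_apply (U : ∀ i, 𝓗 i →L[ℂ] 𝓗 i) (x : PiLp 2 𝓗) (i : Fin 3) :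
    blockDiag U x i = U i (x i) := rfl

end BlockDiag

end CCRMarkov

/-!
Every unitary `e : H ≃ K` between one-particle spaces has a second quantization, the unitary `Γ(e)`
between the Fock spaces with `Γ(e) e(f) = e(e f)` on exponential vectors (`fockMap`). It carries
`W(f)` to `W(e f)` (`fockMap_weyl`), hence conjugation by it carries the statistical operator of
`ω_A` to that of `ω_{e A e⁻¹}` (`IsQuasiFreeStatisticalOperator.conj`).

If `e` is a direct sum of unitaries `eᵢ`, then `Γ(e)` factorizes along every splitting of the
direct sum into two parts (`fockTensor_fockMap`). So it intertwines the partial traces: the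
reductions are conjugated by the second quantizations of the partial sums of the `eᵢ`
(`IsReduction.conj`). Since the functional calculus and the trace are unitarily invariant, all four
entropies are unchanged (`HasEntropy.conj`), and so is the Markov equality. The theorem is the case
`eᵢ = Uᵢ⁻¹`.
-/

namespace CCRMarkov

/-! ### Unitary invariance of trace and entropy -/

section Conj

variable {K L : Type u} [NormedAddCommGroup K] [InnerProductSpace ℂ K]
  [NormedAddCommGroup L] [InnerProductSpace ℂ L]

/-- The image of a Hilbert basis under a unitary. -/
noncomputable def mapHilbertBasis {κ : Type*} (b : HilbertBasis κ ℂ K) (e : K ≃ₗᵢ[ℂ] L) :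
    HilbertBasis κ ℂ L :=
  .ofRepr (e.symm.trans b.repr)

theorem mapHilbertBasis_apply {κ : Type*} (b : HilbertBasis κ ℂ K) (e : K ≃ₗᵢ[ℂ] L) (k : κ) :
    mapHilbertBasis b e k = e (b k) := by
  classical
  rw [← HilbertBasis.repr_symm_single, ← HilbertBasis.repr_symm_single]
  rfl

variable [CompleteSpace K] [CompleteSpace L]

theorem inner_conj (e : K ≃ₗᵢ[ℂ] L) (T : K →L[ℂ] K) (x y : L) :
    ⟪x, e.conjStarAlgEquiv T y⟫_ℂ = ⟪e.symm x, T (e.symm y)⟫_ℂ := by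
  rw [LinearIsometryEquiv.conjStarAlgEquiv_apply_apply, ← e.symm.inner_map_map,
    e.symm_apply_apply]

theorem HasTrace.conj {T : K →L[ℂ] K} {t : ℂ} (h : HasTrace T t) (e : K ≃ₗᵢ[ℂ] L) :
    HasTrace (e.conjStarAlgEquiv T) t := by
  intro κ b
  simpa only [mapHilbertBasis_apply, inner_conj] using h κ (mapHilbertBasis b e.symm)

theorem isPositive_conj {T : K →L[ℂ] K} (h : T.IsPositive) (e : K ≃ₗᵢ[ℂ] L) :
    (e.conjStarAlgEquiv T).IsPositive := by
  rw [← ContinuousLinearMap.nonneg_iff_isPositive] at *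
  exact map_nonneg e.conjStarAlgEquiv h

theorem IsStatisticalOperator.conj {D : K →L[ℂ] K} (h : IsStatisticalOperator D)
    (e : K ≃ₗᵢ[ℂ] L) : IsStatisticalOperator (e.conjStarAlgEquiv D) :=
  ⟨isPositive_conj h.1 e, h.2.conj e⟩

theorem HasEntropy.conj {D : K →L[ℂ] K} {s : ℝ} (h : HasEntropy D s) (e : K ≃ₗᵢ[ℂ] L) :
    HasEntropy (e.conjStarAlgEquiv D) s := by
  have hcfc : e.conjStarAlgEquiv (cfc Real.negMulLog D)
      = cfc Real.negMulLog (e.conjStarAlgEquiv D) := by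
    by_cases hD : IsSelfAdjoint D
    · refine StarAlgHomClass.map_cfc (S := ℂ) e.conjStarAlgEquiv Real.negMulLog D
        Real.continuous_negMulLog.continuousOn ?_ hD (hD.map _)
      exact e.toContinuousLinearEquiv.conjContinuousAlgEquiv.continuous
    · -- Both sides are the junk value `0` of the functional calculus.
      have hD' : ¬ IsSelfAdjoint (e.conjStarAlgEquiv D) := fun h' => hD <| by
        simpa only [StarAlgEquiv.symm_apply_apply] using h'.map e.conjStarAlgEquiv.symm
      rw [cfc_apply_of_not_predicate _ hD, cfc_apply_of_not_predicate _ hD', map_zero]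
  unfold HasEntropy
  exact hcfc ▸ HasTrace.conj h e

end Conj

/-! ### Second quantization of unitaries -/

section SecondQuantization

variable {H K : Type u} [NormedAddCommGroup H] [InnerProductSpace ℂ H] [FiniteDimensional ℂ H]
  [NormedAddCommGroup K] [InnerProductSpace ℂ K] [FiniteDimensional ℂ K]

theorem exists_fockMap (e : H ≃ₗᵢ[ℂ] K) :
    ∃ Γ : Fock H ≃ₗᵢ[ℂ] Fock K, ∀ f : H, Γ (expVec f) = expVec (e f) := by
  obtain ⟨V, hV⟩ := exists_isometry (expVec (H := H)) (fun f => expVec (e f)) span_expVec_dense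
    fun f g => by rw [inner_expVec, inner_expVec, e.inner_map_map]
  obtain ⟨W, hW⟩ := exists_isometry (expVec (H := K)) (fun f => expVec (e.symm f))
    span_expVec_dense fun f g => by rw [inner_expVec, inner_expVec, e.symm.inner_map_map]
  have hVW : V.toContinuousLinearMap ∘L W.toContinuousLinearMap = .id ℂ (Fock K) :=
    ext_expVec fun g => by simp [hV, hW]
  exact ⟨.ofSurjective V fun x => ⟨W x, DFunLike.congr_fun hVW x⟩, hV⟩

/-- The second quantization `Γ(e)` of a unitary `e`: the unitary between the Fock spaces with
`Γ(e) e(f) = e(e f)` on exponential vectors. -/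
noncomputable def fockMap (e : H ≃ₗᵢ[ℂ] K) : Fock H ≃ₗᵢ[ℂ] Fock K :=
  Classical.choose (exists_fockMap e)

theorem fockMap_expVec (e : H ≃ₗᵢ[ℂ] K) (f : H) : fockMap e (expVec f) = expVec (e f) :=
  Classical.choose_spec (exists_fockMap e) f

theorem fockMap_symm (e : H ≃ₗᵢ[ℂ] K) (φ : Fock K) :
    (fockMap e).symm φ = fockMap e.symm φ := by
  have h : ((fockMap e).symm : Fock K →L[ℂ] Fock H) = (fockMap e.symm : Fock K →L[ℂ] Fock H) :=
    ext_expVec fun g => (fockMap e).injective <| by simp [fockMap_expVec]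
  exact DFunLike.congr_fun h φ

/-- Second quantization carries Weyl unitaries to Weyl unitaries. -/
theorem fockMap_weyl (e : H ≃ₗᵢ[ℂ] K) (f : H) :
    (fockMap e).conjStarAlgEquiv (weyl f) = weyl (e f) := by
  refine ext_expVec fun g => ?_
  rw [LinearIsometryEquiv.conjStarAlgEquiv_apply_apply, fockMap_symm, fockMap_expVec, weyl_expVec,
    map_smul, fockMap_expVec, weyl_expVec, map_add, e.apply_symm_apply, e.norm_map,
    ← e.inner_map_map, e.apply_symm_apply]

theorem IsQuasiFreeStatisticalOperator.conj {A : H →L[ℂ] H} {D : Fock H →L[ℂ] Fock H}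
    (h : IsQuasiFreeStatisticalOperator A D) (e : H ≃ₗᵢ[ℂ] K) :
    IsQuasiFreeStatisticalOperator (e.conjStarAlgEquiv A) ((fockMap e).conjStarAlgEquiv D) := by
  refine ⟨h.1.conj _, fun f => ?_⟩
  have h1 := (h.2 (e.symm f)).conj (fockMap e)
  have h2 : (fockMap e).conjStarAlgEquiv (D ∘L weyl (e.symm f))
      = (fockMap e).conjStarAlgEquiv D ∘L weyl f := by
    have hW : (fockMap e).conjStarAlgEquiv (weyl (e.symm f)) = weyl f := by
      rw [fockMap_weyl, e.apply_symm_apply]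
    rw [← hW]
    exact map_mul (fockMap e).conjStarAlgEquiv D (weyl (e.symm f))
  rwa [h2, e.symm.norm_map, ← inner_conj] at h1

end SecondQuantization

/-! ### Direct sums of unitaries and reductions -/

section DirectSum

variable {ι : Type} [Fintype ι] [DecidableEq ι] {𝓗 𝓚 : ι → Type u}
  [∀ i, NormedAddCommGroup (𝓗 i)] [∀ i, InnerProductSpace ℂ (𝓗 i)]
  [∀ i, NormedAddCommGroup (𝓚 i)] [∀ i, InnerProductSpace ℂ (𝓚 i)]

/-- The direct sum of the unitaries `e i` with `i ∈ s`. -/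
noncomputable def subMap (e : ∀ i, 𝓗 i ≃ₗᵢ[ℂ] 𝓚 i) (s : Finset ι) : Sub 𝓗 s ≃ₗᵢ[ℂ] Sub 𝓚 s :=
  .piLpCongrRight 2 fun i : {i // i ∈ s} => e i

theorem glue_subMap (e : ∀ i, 𝓗 i ≃ₗᵢ[ℂ] 𝓚 i) (s : Finset ι) (f : Sub 𝓗 s) (g : Sub 𝓗 sᶜ) :
    glue s (subMap e s f) (subMap e sᶜ g)
      = LinearIsometryEquiv.piLpCongrRight 2 e (glue s f g) := by
  ext i
  by_cases h : i ∈ s <;> simp [glue, subMap, h]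

variable [∀ i, FiniteDimensional ℂ (𝓗 i)] [∀ i, FiniteDimensional ℂ (𝓚 i)]

/-- The second quantization of a direct sum is the tensor product of the second quantizations. -/
theorem fockTensor_fockMap (e : ∀ i, 𝓗 i ≃ₗᵢ[ℂ] 𝓚 i) (s : Finset ι) (φ : Fock (Sub 𝓗 s))
    (χ : Fock (Sub 𝓗 sᶜ)) :
    fockTensor s (fockMap (subMap e s) φ ⊗ₜ[ℂ] fockMap (subMap e sᶜ) χ)
      = fockMap (.piLpCongrRight 2 e) (fockTensor s (φ ⊗ₜ[ℂ] χ)) := by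
  let S : Fock (Sub 𝓗 s) ⊗[ℂ] Fock (Sub 𝓗 sᶜ) →L[ℂ] Fock (PiLp 2 𝓚) :=
    ((fockTensor s).comp (TensorProduct.mapIsometry (fockMap (subMap e s)).toLinearIsometry
      (fockMap (subMap e sᶜ)).toLinearIsometry)).toContinuousLinearMap
  let T : Fock (Sub 𝓗 s) ⊗[ℂ] Fock (Sub 𝓗 sᶜ) →L[ℂ] Fock (PiLp 2 𝓚) :=
    ((fockMap (.piLpCongrRight 2 e)).toLinearIsometry.comp (fockTensor s)).toContinuousLinearMap
  suffices h : S = T from DFunLike.congr_fun h (φ ⊗ₜ[ℂ] χ)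
  refine ContinuousLinearMap.ext_on (dense_span_tmul _ _ (span_expVec_dense (H := Sub 𝓗 s))
    (span_expVec_dense (H := Sub 𝓗 sᶜ))) ?_
  rintro _ ⟨⟨f, g⟩, rfl⟩
  change fockTensor s (fockMap (subMap e s) (expVec f) ⊗ₜ[ℂ] fockMap (subMap e sᶜ) (expVec g))
    = fockMap (.piLpCongrRight 2 e) (fockTensor s (expVec f ⊗ₜ[ℂ] expVec g))
  simp only [fockMap_expVec, fockTensor_expVec, glue_subMap]

theorem IsReduction.conj {s : Finset ι} {D : Fock (PiLp 2 𝓗) →L[ℂ] Fock (PiLp 2 𝓗)}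
    {D' : Fock (Sub 𝓗 s) →L[ℂ] Fock (Sub 𝓗 s)} (h : IsReduction s D D')
    (e : ∀ i, 𝓗 i ≃ₗᵢ[ℂ] 𝓚 i) :
    IsReduction s ((fockMap (.piLpCongrRight 2 e)).conjStarAlgEquiv D)
      ((fockMap (subMap e s)).conjStarAlgEquiv D') := by
  intro κ b φ ψ
  have key : ∀ (φ : Fock (Sub 𝓚 s)) (k : κ),
      (fockMap (.piLpCongrRight 2 e)).symm (fockTensor s (φ ⊗ₜ[ℂ] b k))
        = fockTensor s ((fockMap (subMap e s)).symm φ ⊗ₜ[ℂ]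
            mapHilbertBasis b (fockMap (subMap e sᶜ)).symm k) := by
    intro φ k
    rw [LinearIsometryEquiv.symm_apply_eq, ← fockTensor_fockMap, mapHilbertBasis_apply,
      LinearIsometryEquiv.apply_symm_apply, LinearIsometryEquiv.apply_symm_apply]
  simpa only [inner_conj, key] using h κ (mapHilbertBasis b (fockMap (subMap e sᶜ)).symm)
    ((fockMap (subMap e s)).symm φ) ((fockMap (subMap e s)).symm ψ)

end DirectSum

/-! ### Invariance of Markov triplets -/

section Markov

variable {𝓗 𝓚 : Fin 3 → Type u}
  [∀ i, NormedAddCommGroup (𝓗 i)] [∀ i, InnerProductSpace ℂ (𝓗 i)]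
  [∀ i, FiniteDimensional ℂ (𝓗 i)]
  [∀ i, NormedAddCommGroup (𝓚 i)] [∀ i, InnerProductSpace ℂ (𝓚 i)]
  [∀ i, FiniteDimensional ℂ (𝓚 i)]

theorem IsMarkovTriplet.conj {D : Fock (PiLp 2 𝓗) →L[ℂ] Fock (PiLp 2 𝓗)} (h : IsMarkovTriplet D)
    (e : ∀ i, 𝓗 i ≃ₗᵢ[ℂ] 𝓚 i) :
    IsMarkovTriplet ((fockMap (.piLpCongrRight 2 e)).conjStarAlgEquiv D) := by
  obtain ⟨D₁₂, D₂₃, D₂, s₁₂₃, s₁₂, s₂₃, s₂, r₁₂, r₂₃, r₂, h₁₂₃, h₁₂, h₂₃, h₂, hs⟩ := h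
  exact ⟨_, _, _, s₁₂₃, s₁₂, s₂₃, s₂, r₁₂.conj e, r₂₃.conj e, r₂.conj e,
    h₁₂₃.conj _, h₁₂.conj _, h₂₃.conj _, h₂.conj _, hs⟩

theorem GivesMarkovTriplet.conj {A : PiLp 2 𝓗 →L[ℂ] PiLp 2 𝓗} (h : GivesMarkovTriplet A)
    (e : ∀ i, 𝓗 i ≃ₗᵢ[ℂ] 𝓚 i) :
    GivesMarkovTriplet ((LinearIsometryEquiv.piLpCongrRight 2 e).conjStarAlgEquiv A) := by
  obtain ⟨hA, D, hD, hM⟩ := h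
  exact ⟨isPositive_conj hA _, _, hD.conj _, hM.conj e⟩

end Markov

end CCRMarkov

theorem mainTheorem5 {𝓗 : Fin 3 → Type u} [∀ i, NormedAddCommGroup (𝓗 i)]
    [∀ i, InnerProductSpace ℂ (𝓗 i)] [∀ i, FiniteDimensional ℂ (𝓗 i)]
    [∀ i, CompleteSpace (𝓗 i)]
    (A : PiLp 2 𝓗 →L[ℂ] PiLp 2 𝓗) (hA : CCRMarkov.GivesMarkovTriplet A)
    (U : ∀ i, 𝓗 i →L[ℂ] 𝓗 i) (hU : ∀ i, U i ∈ unitary (𝓗 i →L[ℂ] 𝓗 i)) :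
    CCRMarkov.GivesMarkovTriplet
      (ContinuousLinearMap.adjoint (CCRMarkov.blockDiag U) ∘L A ∘L CCRMarkov.blockDiag U) := by
  let e : ∀ i, 𝓗 i ≃ₗᵢ[ℂ] 𝓗 i := fun i => Unitary.linearIsometryEquiv ⟨U i, hU i⟩
  let V : PiLp 2 𝓗 ≃ₗᵢ[ℂ] PiLp 2 𝓗 := .piLpCongrRight 2 e
  have hV : CCRMarkov.blockDiag U = (V : PiLp 2 𝓗 →L[ℂ] PiLp 2 𝓗) := rfl
  have hadj : ContinuousLinearMap.adjoint (V : PiLp 2 𝓗 →L[ℂ] PiLp 2 𝓗)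
      = (V.symm : PiLp 2 𝓗 →L[ℂ] PiLp 2 𝓗) := V.adjoint_eq_symm
  rw [hV, hadj]
  exact hA.conj fun i => (e i).symm
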